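/- Let $A$ be a countable set, $\mathcal X=A^{\mathbb Z}$ and $\mathcal X_-=A^{\{0,-1,-2,\dots\}}$, both with the product $\sigma$-algebra, and let $\eta_n$ be the coordinate maps on $\mathcal X$. Sequences in $\mathcal X_-$ are written from the present into the past: for $a\in A$, $z\in\mathcal X$ and $x\in\mathcal X_-$, the sequence $ax$ has $a$ at time $0$ followed (backwards in time) by $x$, and $z_{-k}^{-1}x$ is the word $(z_{-1},\dots,z_{-k})$ followed by $x$. A *potential* is a measurable $\phi:\mathcal X_-\to\mathbb R$ with $\sum_{a\in A}e^{\phi(ax)}=1$ for all $x\in\mathcal X_-$. For $k\ge1$ put $$\mathrm{var}_k(\phi)=\sup_{z\in\mathcal X}\sup_{x,y\in\mathcal X_-}\sum_{b\in A}\bigl|\phi(bz_{-k}^{-1}x)-\phi(bz_{-k}^{-1}y)\bigr|,\qquad \chi^2_k(\phi)=\sup_{z\in\mathcal X}\sup_{x,y\in\mathcal X_-}\sum_{b\in A}\frac{\bigl(e^{\phi(bz_{-k}^{-1}x)}-e^{\phi(bz_{-k}^{-1}y)}\bigr)^2}{e^{\phi(bz_{-k}^{-1}y)}}.$$ The potential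 $\phi$ is *regular* if $\mathrm{var}_k(\phi)\to0$ as $k\to\infty$ and there is $\varepsilon>0$ with $e^{\phi(x)}\ge\varepsilon$ for all $x\in\mathcal X_-$ (in particular $A$ is then finite). It satisfies *Assumption (A)* with constants $C,\delta>0$ if $\chi^2_k(\phi)\le C/k^{1+\delta}$ for all $k\ge1$. A probability measure $\mu$ on $\mathcal X$ is *compatible* with $\phi$ if its image under $\eta_{-\infty}^0:=(\eta_0,\eta_{-1},\dots)$ is some probability measure on $\mathcal X_-$ and, for every $n\ge1$ and $a\in A$, $\mu[\eta_{n+1}=a\mid\eta_{-\infty}^n=x]=e^{\phi(ax)}$ for almost every $x$, where $\eta_{-\infty}^n:=(\eta_n,\eta_{n-1},\dots)$. **Proposition.** Let $C>0$, $\delta\in(1/2,1]$, $\delta'<2\delta-1$ and $\varepsilon>0$. There is a constant $C_7>0$, depending only on $C,\delta,\delta'$ and $\varepsilon$, such that the following holds for every countable set $A$, every regular potential $\phi$ on $\mathcal X_-$ with $e^{\phi}\ge\varepsilon$ that satisfies Assumption (A) with the constants $C$ and $\delta$, and every probability measure $\mu$ compatible with $\phi$: for all $n\ge1$, $t\ge0$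 and $h:A\to\mathbb R$, $$\mu\left[\left|\frac1n\sum_{i=1}^n\bigl(h(\eta_i)-\mathbb E[h(\eta_i)]\bigr)\right|\ge t\right]\le 2\exp\left(-\frac{C_7\,n^{\delta'}\,t^2}{R(h)^2}\right),$$ where $\mathbb E$ is the expectation under $\mu$ and $R(h)=\max_{a\in A}h(a)-\min_{a\in A}h(a)$. (If $h$ is constant, so that $R(h)=0$, the fraction is read as $0$; the left-hand side is then $0$ for $t>0$.) -/

import Mathlib

open MeasureTheory ProbabilityTheory Filter Topology
open scoped ENNReal

noncomputable section

/-- Bi-infinite sequences over the alphabet `A`, with the product σ-algebra. -/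
abbrev BiSeq (A : Type*) := ℤ → A

/-- One-sided sequences indexed by the non-positive integers. For `x : Past A` and `i : ℕ`, the
letter `x i` is the coordinate of `x` at time `-i`, so increasing `i` goes further into the past. -/
abbrev Past (A : Type*) := ℕ → A

/-- The concatenation `a x`: the letter `a` at time `0`, preceded by the past `x`. -/
def consPast {A : Type*} (a : A) (x : Past A) : Past A
  | 0 => a
  | i + 1 => x i

/-- The concatenation of the word `(z (-1), …, z (-k))` of length `k` with the past `x`. -/
def concatPast {A : Type*} (z : BiSeq A) (k : ℕ) (x : Past A) : Past A :=
  fun i => if i < k then z (-((i : ℤ) + 1)) else x (i - k)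

/-- The sequence `(ω n, ω (n - 1), ω (n - 2), …)`, that is, the past of `ω` up to time `n`. -/
def pastOf {A : Type*} (n : ℤ) (ω : BiSeq A) : Past A := fun i => ω (n - i)

/-- Potentials: measurable functions `φ` with `∑ a, exp (φ (a x)) = 1` for every past `x`. -/
structure IsPotential {A : Type*} [MeasurableSpace A] (φ : Past A → ℝ) : Prop where
  measurable : Measurable φ
  normalized : ∀ x : Past A, HasSum (fun a : A => Real.exp (φ (consPast a x))) 1

/-- The variation rate of order `k`, as an extended nonnegative real. -/
def varRate {A : Type*} (φ : Past A → ℝ) (k : ℕ) : ℝ≥0∞ :=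
  ⨆ (z : BiSeq A) (x : Past A) (y : Past A), ∑' b : A,
    ENNReal.ofReal
      |φ (consPast b (concatPast z k x)) - φ (consPast b (concatPast z k y))|

/-- The `χ²`-variation rate of order `k`, as an extended nonnegative real. -/
def chiSqRate {A : Type*} (φ : Past A → ℝ) (k : ℕ) : ℝ≥0∞ :=
  ⨆ (z : BiSeq A) (x : Past A) (y : Past A), ∑' b : A,
    ENNReal.ofReal
      ((Real.exp (φ (consPast b (concatPast z k x)))
          - Real.exp (φ (consPast b (concatPast z k y)))) ^ 2
        / Real.exp (φ (consPast b (concatPast z k y))))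

/-- Regularity: continuity (the variation rates tend to zero) and positivity of the kernel
`exp φ`, uniformly over all pasts. -/
structure IsRegularPotential {A : Type*} (φ : Past A → ℝ) : Prop where
  continuity : Tendsto (fun k : ℕ => varRate φ k) atTop (𝓝 0)
  positivity : ∃ ε : ℝ, 0 < ε ∧ ∀ x : Past A, ε ≤ Real.exp (φ x)

/-- `φ` is a potential whose `χ²`-variation rate of every order `k ≥ 1` is at most
`C / k ^ (1 + δ)`. -/
structure AssumptionA {A : Type*} [MeasurableSpace A] (φ : Past A → ℝ) (C δ : ℝ) : Prop where
  potential : IsPotential φ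
  C_pos : 0 < C
  δ_pos : 0 < δ
  bound : ∀ k : ℕ, 1 ≤ k → chiSqRate φ k ≤ ENNReal.ofReal (C / (k : ℝ) ^ (1 + δ))

/-- A probability measure `μ` on bi-infinite sequences is compatible with `φ` if its past up to
time `0` has some law `P` and, for `n ≥ 1`, the conditional probability that the coordinate at time
`n + 1` is `a`, given the past `x` up to time `n`, is `exp (φ (a x))`. -/
structure IsCompatible {A : Type*} [MeasurableSpace A] (φ : Past A → ℝ)
    (μ : Measure (BiSeq A)) : Prop where
  isProbabilityMeasure : IsProbabilityMeasure μ
  past_law : ∃ P : Measure (Past A), IsProbabilityMeasure P ∧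
    ∀ B : Set (Past A), MeasurableSet B → μ {ω | pastOf 0 ω ∈ B} = P B
  cond_prob : ∀ n : ℕ, 1 ≤ n → ∀ a : A,
    μ⟦{ω : BiSeq A | ω ((n : ℤ) + 1) = a} |
        MeasurableSpace.comap (pastOf (A := A) (n : ℤ)) inferInstance⟧
      =ᵐ[μ] fun ω => Real.exp (φ (consPast a (pastOf (n : ℤ) ω)))

/-- The range `max h - min h` of a function (used for finite nonempty `A`, where the supremum and
the infimum are attained). -/
def oscRange {A : Type*} (h : A → ℝ) : ℝ := (⨆ a, h a) - ⨅ a, h a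

end

/-! Let `P` be the transfer operator and `F x = h (x 0)`. In the Doob martingale of `∑ h (η_i)`,
each increment has conditional range at most `c = ∑_{j<n} osc (P^j F)`. Hoeffding's lemma at each of
the `n` times gives variance proxy `n c² / 4` (`hasSubgaussianMGF_sum`), so everything rests on `c ≤
K n^(1-ρ) R(h)` for some `ρ < δ` with `2ρ - 1 ≥ δ'` (`exists_sum_ageOsc_le`).

That bound is a coupling argument in analytic form. Let `γ k j` be the oscillation of `P^j F` over
pasts sharing `k` letters. Second moments of likelihood ratios multiply along words, so a block of
length `L` begun with `k` common letters has laws at `L¹` distance at most `p = (exp (L C / k^(1+δ))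
- 1)^(1/2)`; the square root is taken once per block, not once per letter. Failure resets the
memory: `γ k (j+L) ≤ γ (k+L) j + p γ 0 j`. From no common letters, positivity creates `t 0` of them
with probability `ε^(t 0)`.

With block times of order `l^(1/ρ)` the `p l` are of order `l^(-(1+δ/ρ)/2)`, hence summable. Once
their sum is at most `1/2` the recursion closes (`sum_range_le_of_blocks`), and `c` is of the order
of the longest block before time `n`, namely `n^(1-ρ)`. -/

noncomputable section

/-! ### Laws of words and their `χ²` comparison. -/

section Words

variable {A : Type*}

/-- The past obtained by prepending the word `w`, whose most recent letter is `w 0`. -/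
def prependWord : (L : ℕ) → (Fin L → A) → Past A → Past A
  | 0, _, x => x
  | L + 1, w, x => consPast (w 0) (prependWord L (Fin.tail w) x)

/-- The probability that, after the past `x`, the chain with kernel `exp φ` produces the word `w`,
whose most recent letter is `w 0`. -/
def wordProb (φ : Past A → ℝ) : (L : ℕ) → (Fin L → A) → Past A → ℝ
  | 0, _, _ => 1
  | L + 1, w, x => Real.exp (φ (consPast (w 0) (prependWord L (Fin.tail w) x)))
      * wordProb φ L (Fin.tail w) x

/-- The pasts `x` and `y` have the same `k` most recent letters. -/
def AgreeUpTo (k : ℕ) (x y : Past A) : Prop := ∀ i < k, x i = y i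

lemma AgreeUpTo.consPast {k : ℕ} {x y : Past A} (hxy : AgreeUpTo k x y) (a : A) :
    AgreeUpTo (k + 1) (consPast a x) (consPast a y) := by
  intro i hi
  cases i with
  | zero => rfl
  | succ i => exact hxy i (by omega)

lemma AgreeUpTo.prependWord {k : ℕ} {x y : Past A} (hxy : AgreeUpTo k x y) :
    ∀ (L : ℕ) (w : Fin L → A), AgreeUpTo (k + L) (prependWord L w x) (prependWord L w y)
  | 0, _ => hxy
  | L + 1, w => (AgreeUpTo.prependWord hxy L (Fin.tail w)).consPast (w 0)

lemma agreeUpTo_zero (x y : Past A) : AgreeUpTo 0 x y := fun _ hi => absurd hi (Nat.not_lt_zero _)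

lemma wordProb_pos (φ : Past A → ℝ) (x : Past A) :
    ∀ (L : ℕ) (w : Fin L → A), 0 < wordProb φ L w x
  | 0, _ => one_pos
  | L + 1, w => mul_pos (Real.exp_pos _) (wordProb_pos φ x L (Fin.tail w))

lemma pow_le_wordProb {φ : Past A → ℝ} {ε : ℝ} (hε : 0 ≤ ε) (hφ : ∀ x, ε ≤ Real.exp (φ x))
    (x : Past A) : ∀ (L : ℕ) (w : Fin L → A), ε ^ L ≤ wordProb φ L w x
  | 0, _ => by simp [wordProb]
  | L + 1, w => by
    rw [pow_succ', wordProb]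
    exact mul_le_mul (hφ _) (pow_le_wordProb hε hφ x L _) (pow_nonneg hε L) (Real.exp_pos _).le

/-- The word `(z (-1), …, z (-k))` and the past that follows it, for a past `x`. -/
lemma exists_concatPast (k : ℕ) {x y : Past A} (hxy : AgreeUpTo k x y) :
    ∃ (z : BiSeq A) (x' y' : Past A), concatPast z k x' = x ∧ concatPast z k y' = y := by
  -- `m ↦ -m - 1` inverts the indexing `i ↦ -(i + 1)` of `concatPast`.
  refine ⟨fun m => x (-m - 1).toNat, fun i => x (i + k), fun i => y (i + k), ?_, ?_⟩
  all_goals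
    funext i
    unfold concatPast
    split_ifs with hi
  · exact congrArg x (by omega)
  · exact congrArg x (by omega)
  · rw [← hxy i hi]
    exact congrArg x (by omega)
  · exact congrArg y (by omega)

variable [Fintype A]

/-- The transfer operator of `φ`: the expectation of `F` one step ahead. -/
def transfer (φ F : Past A → ℝ) : Past A → ℝ :=
  fun x => ∑ a, Real.exp (φ (consPast a x)) * F (consPast a x)

lemma sum_words_succ {L : ℕ} (f : (Fin (L + 1) → A) → ℝ) :
    ∑ w, f w = ∑ w : Fin L → A, ∑ a, f (Fin.cons a w) := by
  rw [← (Fin.consEquiv (fun _ : Fin (L + 1) => A)).sum_comp, Fintype.sum_prod_type,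
    Finset.sum_comm]
  rfl

lemma transfer_iterate (φ : Past A → ℝ) (x : Past A) : ∀ (L : ℕ) (F : Past A → ℝ),
    (transfer φ)^[L] F x = ∑ w, wordProb φ L w x * F (prependWord L w x)
  | 0, F => by simp [wordProb, prependWord]
  | L + 1, F => by
    rw [Function.iterate_succ_apply, transfer_iterate φ x L, sum_words_succ]
    refine Finset.sum_congr rfl fun w _ => ?_
    rw [transfer, Finset.mul_sum]
    refine Finset.sum_congr rfl fun a _ => ?_
    simp only [wordProb, prependWord, Fin.cons_zero, Fin.tail_cons]
    ring

variable {φ : Past A → ℝ} (hφ : ∀ x, ∑ a, Real.exp (φ (consPast a x)) = 1)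
include hφ

lemma sum_wordProb (x : Past A) : ∀ L : ℕ, ∑ w, wordProb φ L w x = 1
  | 0 => by simp [wordProb]
  | L + 1 => by
    rw [sum_words_succ, ← sum_wordProb x L]
    refine Finset.sum_congr rfl fun w _ => ?_
    simp only [wordProb, Fin.cons_zero, Fin.tail_cons]
    rw [← Finset.sum_mul, hφ, one_mul]

lemma transfer_mem_Icc {F : Past A → ℝ} {m M : ℝ} (hF : ∀ x, F x ∈ Set.Icc m M) (x : Past A) :
    transfer φ F x ∈ Set.Icc m M := by
  constructor
  · calc m = ∑ a, Real.exp (φ (consPast a x)) * m := by rw [← Finset.sum_mul, hφ, one_mul]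
      _ ≤ _ := Finset.sum_le_sum fun a _ => mul_le_mul_of_nonneg_left (hF _).1 (Real.exp_pos _).le
  · calc _ ≤ ∑ a, Real.exp (φ (consPast a x)) * M :=
          Finset.sum_le_sum fun a _ => mul_le_mul_of_nonneg_left (hF _).2 (Real.exp_pos _).le
      _ = M := by rw [← Finset.sum_mul, hφ, one_mul]

lemma transfer_iterate_mem_Icc {F : Past A → ℝ} {m M : ℝ} (hF : ∀ x, F x ∈ Set.Icc m M) (j : ℕ) :
    ∀ x, (transfer φ)^[j] F x ∈ Set.Icc m M := by
  induction j with
  | zero => exact hF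
  | succ j ih =>
    rw [Function.iterate_succ_apply']
    exact transfer_mem_Icc hφ ih

/-- Both kernels have mass 1, so expanding the square turns the divergence into a second moment, the
quantity that multiplies along words. -/
lemma sum_sq_div_le {u : ℝ} {x y : Past A}
    (h : ∑ b, (Real.exp (φ (consPast b x)) - Real.exp (φ (consPast b y))) ^ 2
      / Real.exp (φ (consPast b y)) ≤ u) :
    ∑ b, Real.exp (φ (consPast b x)) ^ 2 / Real.exp (φ (consPast b y)) ≤ 1 + u := by
  have key : ∑ b, Real.exp (φ (consPast b x)) ^ 2 / Real.exp (φ (consPast b y))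
      = ∑ b, (Real.exp (φ (consPast b x)) - Real.exp (φ (consPast b y))) ^ 2
          / Real.exp (φ (consPast b y))
        + 2 * ∑ b, Real.exp (φ (consPast b x)) - ∑ b, Real.exp (φ (consPast b y)) := by
    rw [Finset.mul_sum, ← Finset.sum_add_distrib, ← Finset.sum_sub_distrib]
    refine Finset.sum_congr rfl fun b _ => ?_
    have := (Real.exp_pos (φ (consPast b y))).ne'
    field_simp
    ring
  rw [key, hφ, hφ]
  linarith

-- Letters produced in common only lengthen the agreement, so the same `u` serves throughout and
-- each letter costs a factor `1 + u`.
omit hφ in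
lemma sum_wordProb_sq_div_le {u : ℝ} (hu : 0 ≤ u) {k : ℕ}
    (hk : ∀ j, k ≤ j → ∀ x y : Past A, AgreeUpTo j x y →
      ∑ b, Real.exp (φ (consPast b x)) ^ 2 / Real.exp (φ (consPast b y)) ≤ 1 + u)
    {x y : Past A} (hxy : AgreeUpTo k x y) :
    ∀ L : ℕ, ∑ w, wordProb φ L w x ^ 2 / wordProb φ L w y ≤ (1 + u) ^ L
  | 0 => by simp [wordProb]
  | L + 1 => by
    rw [sum_words_succ, pow_succ]
    calc _ ≤ ∑ w, wordProb φ L w x ^ 2 / wordProb φ L w y * (1 + u) := by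
          refine Finset.sum_le_sum fun w _ => ?_
          simp only [wordProb, Fin.cons_zero, Fin.tail_cons, mul_pow]
          simp_rw [mul_div_mul_comm]
          rw [← Finset.sum_mul, mul_comm]
          exact mul_le_mul_of_nonneg_left (hk _ (Nat.le_add_right k L) _ _ (hxy.prependWord L w))
            (div_nonneg (sq_nonneg _) (wordProb_pos φ y L w).le)
      _ ≤ _ := by
          rw [← Finset.sum_mul]
          exact mul_le_mul_of_nonneg_right (sum_wordProb_sq_div_le hu hk hxy L) (by linarith)

/-- The total variation distance of the laws of a word is controlled by their `χ²` divergence. -/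
lemma sum_abs_wordProb_sub_sq_le (x y : Past A) (L : ℕ) :
    (∑ w, |wordProb φ L w x - wordProb φ L w y|) ^ 2
      ≤ ∑ w, wordProb φ L w x ^ 2 / wordProb φ L w y - 1 := by
  have h1 := Finset.sum_sq_le_sum_mul_sum_of_sq_le_mul Finset.univ
    (r := fun w => |wordProb φ L w x - wordProb φ L w y|)
    (f := fun w => (wordProb φ L w x - wordProb φ L w y) ^ 2 / wordProb φ L w y)
    (g := fun w => wordProb φ L w y)
    (fun w _ => div_nonneg (sq_nonneg _) (wordProb_pos φ y L w).le)
    (fun w _ => (wordProb_pos φ y L w).le)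
    (fun w _ => by rw [sq_abs, div_mul_cancel₀ _ (wordProb_pos φ y L w).ne'])
  rw [sum_wordProb hφ, mul_one] at h1
  refine h1.trans (le_of_eq ?_)
  have : ∑ w, (wordProb φ L w x - wordProb φ L w y) ^ 2 / wordProb φ L w y
      = ∑ w, wordProb φ L w x ^ 2 / wordProb φ L w y
        - 2 * ∑ w, wordProb φ L w x + ∑ w, wordProb φ L w y := by
    rw [Finset.mul_sum, ← Finset.sum_sub_distrib, ← Finset.sum_add_distrib]
    refine Finset.sum_congr rfl fun w _ => ?_
    have := (wordProb_pos φ y L w).ne'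
    field_simp
    ring
  rw [this, sum_wordProb hφ, sum_wordProb hφ]
  ring

lemma sum_abs_wordProb_sub_le {u p : ℝ} (hu : 0 ≤ u) (hp : 0 ≤ p) {k L : ℕ}
    (hk : ∀ j, k ≤ j → ∀ x y : Past A, AgreeUpTo j x y →
      ∑ b, (Real.exp (φ (consPast b x)) - Real.exp (φ (consPast b y))) ^ 2
        / Real.exp (φ (consPast b y)) ≤ u)
    (hpL : Real.exp (L * u) - 1 ≤ p ^ 2) {x y : Past A} (hxy : AgreeUpTo k x y) :
    ∑ w, |wordProb φ L w x - wordProb φ L w y| ≤ p := by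
  refine abs_le_of_sq_le_sq' ?_ hp |>.2
  refine (sum_abs_wordProb_sub_sq_le hφ x y L).trans (le_trans ?_ hpL)
  have h1 := sum_wordProb_sq_div_le hu
    (fun j hj x y h => sum_sq_div_le hφ (hk j hj x y h)) hxy L
  have h2 : (1 + u) ^ L ≤ Real.exp (L * u) := by
    rw [Real.exp_nat_mul]
    refine pow_le_pow_left₀ (by linarith) ?_ L
    linarith [Real.add_one_le_exp u]
  linarith

end Words

/-! ### Oscillation of iterates and the two coupling inequalities. -/

section Oscillation

variable {A : Type*}

/-- The oscillation of `F` over pairs of pasts that agree in their `k` most recent letters. -/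
def ageOsc (F : Past A → ℝ) (k : ℕ) : ℝ :=
  ⨆ q : {q : Past A × Past A // AgreeUpTo k q.1 q.2}, |F q.1.1 - F q.1.2|

lemma ageOsc_nonneg (F : Past A → ℝ) (k : ℕ) : 0 ≤ ageOsc F k :=
  Real.iSup_nonneg fun _ => abs_nonneg _

lemma ageOsc_le {F : Past A → ℝ} {k : ℕ} {B : ℝ} (hB : 0 ≤ B)
    (h : ∀ x y, AgreeUpTo k x y → |F x - F y| ≤ B) : ageOsc F k ≤ B :=
  Real.iSup_le (fun q => h _ _ q.2) hB

lemma abs_sub_le_sub_of_mem_Icc {a b m M : ℝ} (ha : a ∈ Set.Icc m M) (hb : b ∈ Set.Icc m M) :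
    |a - b| ≤ M - m :=
  abs_le.2 ⟨by linarith [ha.1, hb.2], by linarith [ha.2, hb.1]⟩

/-- Boundedness matters here: a real supremum over an unbounded family is 0 by default. -/
lemma abs_sub_le_ageOsc {F : Past A → ℝ} {m M : ℝ} (hF : ∀ x, F x ∈ Set.Icc m M) {k : ℕ}
    {x y : Past A} (hxy : AgreeUpTo k x y) : |F x - F y| ≤ ageOsc F k :=
  le_ciSup (f := fun q : {q : Past A × Past A // AgreeUpTo k q.1 q.2} => |F q.1.1 - F q.1.2|)
    ⟨M - m, by rintro _ ⟨q, rfl⟩; exact abs_sub_le_sub_of_mem_Icc (hF _) (hF _)⟩ ⟨(x, y), hxy⟩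

variable [Fintype A] {φ : Past A → ℝ} (hφ : ∀ x, ∑ a, Real.exp (φ (consPast a x)) = 1)
include hφ

/-- One block of the coupling: either the block agrees, or the memory is lost. -/
lemma ageOsc_transfer_iterate_le {F : Past A → ℝ} {m M p : ℝ} (hF : ∀ x, F x ∈ Set.Icc m M)
    (hp : 0 ≤ p) {k L : ℕ}
    (hTV : ∀ x y : Past A, AgreeUpTo k x y → ∑ w, |wordProb φ L w x - wordProb φ L w y| ≤ p) :
    ageOsc ((transfer φ)^[L] F) k ≤ ageOsc F (k + L) + p * ageOsc F 0 := by
  refine ageOsc_le (add_nonneg (ageOsc_nonneg _ _) (mul_nonneg hp (ageOsc_nonneg _ _)))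
    fun x y hxy => ?_
  -- The difference of the two laws has mass zero, so a constant may be subtracted from `F`; taking
  -- `F x` leaves an oscillation. The first sum is the matched block, the second the failure.
  have key : (transfer φ)^[L] F x - (transfer φ)^[L] F y
      = ∑ w, wordProb φ L w x * (F (prependWord L w x) - F (prependWord L w y))
        + ∑ w, (wordProb φ L w x - wordProb φ L w y) * (F (prependWord L w y) - F x) := by
    have h0 : ∑ w, (wordProb φ L w x - wordProb φ L w y) * F x = 0 := by
      rw [← Finset.sum_mul, Finset.sum_sub_distrib, sum_wordProb hφ, sum_wordProb hφ]
      ring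
    rw [transfer_iterate, transfer_iterate, ← sub_zero (∑ w, _ * _ - _), ← h0,
      ← Finset.sum_sub_distrib, ← Finset.sum_sub_distrib, ← Finset.sum_add_distrib]
    exact Finset.sum_congr rfl fun w _ => by ring
  rw [key]
  refine (abs_add_le _ _).trans (add_le_add ?_ ?_)
  · calc _ ≤ ∑ w, |wordProb φ L w x * (F (prependWord L w x) - F (prependWord L w y))| :=
          Finset.abs_sum_le_sum_abs _ _
      _ ≤ ∑ w, wordProb φ L w x * ageOsc F (k + L) := by
          refine Finset.sum_le_sum fun w _ => ?_
          rw [abs_mul, abs_of_pos (wordProb_pos φ x L w)]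
          exact mul_le_mul_of_nonneg_left (abs_sub_le_ageOsc hF (hxy.prependWord L w))
            (wordProb_pos φ x L w).le
      _ = _ := by rw [← Finset.sum_mul, sum_wordProb hφ, one_mul]
  · calc _ ≤ ∑ w, |(wordProb φ L w x - wordProb φ L w y) * (F (prependWord L w y) - F x)| :=
          Finset.abs_sum_le_sum_abs _ _
      _ ≤ ∑ w, |wordProb φ L w x - wordProb φ L w y| * ageOsc F 0 := by
          refine Finset.sum_le_sum fun w _ => ?_
          rw [abs_mul]
          exact mul_le_mul_of_nonneg_left (abs_sub_le_ageOsc hF (agreeUpTo_zero _ _))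
            (abs_nonneg _)
      _ ≤ _ := by
          rw [← Finset.sum_mul]
          exact mul_le_mul_of_nonneg_right (hTV x y hxy) (ageOsc_nonneg _ _)

-- The two weights have equal mass `s`, so both sums can be compared with `s` times the minimum of
-- `g`.
omit hφ in
lemma sum_mul_sub_sum_mul_le {ι : Type*} [Fintype ι] [Nonempty ι] {a b f g : ι → ℝ} {s G : ℝ}
    (ha : ∀ i, 0 ≤ a i) (hb : ∀ i, 0 ≤ b i) (has : ∑ i, a i = s) (hbs : ∑ i, b i = s)
    (hfg : ∀ i j, f i - g j ≤ G) : ∑ i, a i * f i - ∑ i, b i * g i ≤ s * G := by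
  obtain ⟨j, hj⟩ := Finite.exists_min g
  have h1 : ∑ i, a i * f i ≤ s * (G + g j) := by
    rw [← has, Finset.sum_mul]
    exact Finset.sum_le_sum fun i _ =>
      mul_le_mul_of_nonneg_left (by linarith [hfg i j]) (ha i)
  have h2 : s * g j ≤ ∑ i, b i * g i := by
    rw [← hbs, Finset.sum_mul]
    exact Finset.sum_le_sum fun i _ => mul_le_mul_of_nonneg_left (hj i) (hb i)
  linarith

/-- Two chains with arbitrary pasts produce a common word of length `L` with probability at least
`ε ^ L`. -/
lemma ageOsc_transfer_iterate_zero_le [Nonempty A] {F : Past A → ℝ} {m M ε : ℝ}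
    (hF : ∀ x, F x ∈ Set.Icc m M) (hε : 0 ≤ ε) (hε1 : ε ≤ 1) (hφε : ∀ x, ε ≤ Real.exp (φ x))
    (L : ℕ) :
    ageOsc ((transfer φ)^[L] F) 0 ≤ ε ^ L * ageOsc F L + (1 - ε ^ L) * ageOsc F 0 := by
  classical
  have hc0 : 0 ≤ ε ^ L := pow_nonneg hε L
  have hc1 : ε ^ L ≤ 1 := pow_le_one₀ hε hε1
  -- One fixed word suffices: mass `ε ^ L` at `w₀` is split off from both laws, leaving weights of
  -- mass `1 - ε ^ L`.
  obtain ⟨w₀⟩ : Nonempty (Fin L → A) := inferInstance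
  have one_side : ∀ x y : Past A, (transfer φ)^[L] F x - (transfer φ)^[L] F y
      ≤ ε ^ L * ageOsc F L + (1 - ε ^ L) * ageOsc F 0 := by
    intro x y
    have hnn : ∀ (z : Past A) (w : Fin L → A),
        0 ≤ wordProb φ L w z - if w = w₀ then ε ^ L else 0 := by
      intro z w
      split_ifs
      · linarith [pow_le_wordProb hε hφε z L w]
      · linarith [wordProb_pos φ z L w]
    have hs : ∀ z : Past A,
        ∑ w, (wordProb φ L w z - if w = w₀ then ε ^ L else 0) = 1 - ε ^ L := by
      intro z
      rw [Finset.sum_sub_distrib, sum_wordProb hφ]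
      simp
    have h1 := sum_mul_sub_sum_mul_le (hnn x) (hnn y) (hs x) (hs y)
      (f := fun w => F (prependWord L w x)) (g := fun w => F (prependWord L w y))
      (fun v w => (le_abs_self _).trans (abs_sub_le_ageOsc hF (agreeUpTo_zero _ _)))
    have h2 : F (prependWord L w₀ x) - F (prependWord L w₀ y) ≤ ageOsc F L := by
      refine (le_abs_self _).trans (abs_sub_le_ageOsc hF ?_)
      simpa using (agreeUpTo_zero x y).prependWord L w₀
    have h3 := mul_le_mul_of_nonneg_left h2 hc0
    simp only [sub_mul, Finset.sum_sub_distrib, ite_mul, zero_mul, Finset.sum_ite_eq',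
      Finset.mem_univ, if_true] at h1
    rw [transfer_iterate, transfer_iterate]
    linarith
  refine ageOsc_le (add_nonneg (mul_nonneg hc0 (ageOsc_nonneg _ _))
    (mul_nonneg (by linarith) (ageOsc_nonneg _ _))) fun x y _ => ?_
  rw [abs_le]
  constructor <;> linarith [one_side x y, one_side y x]

end Oscillation

/-! ### Choice of the blocks and summation of the recursion. -/

section Blocks

/-- Lengths of the blocks between the times `⌈l ^ r⌉`. -/
lemma ceil_rpow_succ_sub_le {r : ℝ} (hr1 : 1 ≤ r) (hr2 : r ≤ 2) {l : ℕ} (hl : 1 ≤ l) :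
    ((⌈((l + 1 : ℕ) : ℝ) ^ r⌉₊ : ℝ) - ⌈(l : ℝ) ^ r⌉₊) ≤ 5 * (l : ℝ) ^ (r - 1) := by
  have hl0 : (1 : ℝ) ≤ l := by exact_mod_cast hl
  have h1 : (⌈((l + 1 : ℕ) : ℝ) ^ r⌉₊ : ℝ) < ((l + 1 : ℕ) : ℝ) ^ r + 1 :=
    Nat.ceil_lt_add_one (by positivity)
  have h2 := Nat.le_ceil ((l : ℝ) ^ r)
  have h3 : (1 : ℝ) ≤ (l : ℝ) ^ (r - 1) := Real.one_le_rpow hl0 (by linarith)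
  -- Mean value bound, from Bernoulli's inequality at `-1 / (l + 1)`.
  have h4 : ((l + 1 : ℕ) : ℝ) ^ r - (l : ℝ) ^ r ≤ r * ((l + 1 : ℕ) : ℝ) ^ (r - 1) := by
    push_cast
    have hpos : (0 : ℝ) < l + 1 := by linarith
    have hb := one_add_mul_self_le_rpow_one_add (s := -1 / ((l : ℝ) + 1))
      (by rw [le_div_iff₀ hpos]; linarith) hr1
    have e1 : 1 + -1 / ((l : ℝ) + 1) = l / (l + 1) := by field_simp; ring
    rw [e1, Real.div_rpow (by linarith) hpos.le, le_div_iff₀ (by positivity)] at hb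
    have e2 : ((l : ℝ) + 1) ^ (r - 1) = (l + 1) ^ r / (l + 1) := by
      rw [Real.rpow_sub hpos, Real.rpow_one]
    rw [e2]
    have e3 : (1 + r * (-1 / ((l : ℝ) + 1))) * (l + 1) ^ r
      = (l + 1 : ℝ) ^ r - r * ((l + 1 : ℝ) ^ r / (l + 1)) := by ring
    linarith
  have h5 : ((l + 1 : ℕ) : ℝ) ^ (r - 1) ≤ 2 * (l : ℝ) ^ (r - 1) := by
    calc ((l + 1 : ℕ) : ℝ) ^ (r - 1) ≤ (2 * l : ℝ) ^ (r - 1) := by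
          refine Real.rpow_le_rpow (by positivity) ?_ (by linarith)
          push_cast; linarith
      _ = (2 : ℝ) ^ (r - 1) * (l : ℝ) ^ (r - 1) := Real.mul_rpow (by norm_num) (by linarith)
      _ ≤ 2 * (l : ℝ) ^ (r - 1) := by
          refine mul_le_mul_of_nonneg_right ?_ (by positivity)
          calc (2 : ℝ) ^ (r - 1) ≤ 2 ^ (1 : ℝ) :=
                Real.rpow_le_rpow_of_exponent_le (by norm_num) (by linarith)
            _ = 2 := Real.rpow_one 2
  -- The constant 5: `r ≤ 2` and `h5` give 4, and rounding up costs at most `1 ≤ l ^ (r - 1)`.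
  nlinarith

/-- The block times of the coupling: the failure probabilities of the blocks sum to at most `1/2`,
and the blocks before time `n` have length `O(n ^ (1 - ρ))`. -/
lemma exists_blocks {C δ ρ : ℝ} (hC : 0 < C) (hρ : 1 / 2 ≤ ρ) (hρδ : ρ < δ) (hδ1 : δ ≤ 1) :
    ∃ (t : ℕ → ℕ) (p : ℕ → ℝ) (K : ℝ), 1 ≤ t 0 ∧ Monotone t ∧ (∀ l, 0 ≤ p l) ∧
      (∀ N, ∑ l ∈ Finset.range N, p l ≤ 1 / 2) ∧
      (∀ l, Real.exp (((t (l + 1) - t l : ℕ) : ℝ) * (C / (t l : ℝ) ^ (1 + δ))) - 1 ≤ p l ^ 2) ∧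
      0 < K ∧ ∀ n : ℕ, 1 ≤ n → ∃ N, n ≤ t N ∧
        ∀ l < N, ((t (l + 1) - t l : ℕ) : ℝ) ≤ K * (n : ℝ) ^ (1 - ρ) := by
  have hρ0 : 0 < ρ := by linarith
  set r : ℝ := ρ⁻¹ with hr
  have hρr : ρ * r = 1 := mul_inv_cancel₀ hρ0.ne'
  have hr1 : 1 ≤ r := by rw [hr, one_le_inv₀ hρ0]; linarith
  have hr2 : r ≤ 2 := by
    rw [hr, inv_le_comm₀ hρ0 (by norm_num)]; linarith
  have hrδ : 1 < r * δ := by nlinarith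
  -- Gap `l^(r-1)` times rate `l^(-r(1+δ))` is `l^(-(1+rδ))`; its square root is summable because `r
  -- δ > 1`. The constant comes from `exp s - 1 ≤ s exp s` with `s ≤ 5C`.
  set q : ℕ → ℝ := fun l => Real.sqrt (5 * C * Real.exp (5 * C)) * (1 / (l : ℝ) ^ ((1 + r * δ) / 2))
    with hq
  have hqs : Summable q :=
    (Real.summable_one_div_nat_rpow.2 (by linarith)).mul_left _
  have hq0 : ∀ l, 0 ≤ q l := fun l => by positivity
  -- Starting the blocks at index `i₀` brings the total failure probability down to `1/2`.
  obtain ⟨i₀, hi₀⟩ : ∃ i₀ : ℕ, ∑' k, q (k + i₀) ≤ 1 / 2 ∧ 1 ≤ i₀ :=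
    (((tendsto_sum_nat_add q).eventually_le_const (by norm_num)).and
      (eventually_ge_atTop 1)).exists
  obtain ⟨hi₀, hi1⟩ := hi₀
  have hmono : Monotone fun l : ℕ => ⌈((l + i₀ : ℕ) : ℝ) ^ r⌉₊ := by
    intro a b hab
    refine Nat.ceil_le_ceil (Real.rpow_le_rpow (by positivity) ?_ (by linarith))
    exact_mod_cast Nat.add_le_add_right hab i₀
  have hlen : ∀ l : ℕ, ((⌈((l + 1 + i₀ : ℕ) : ℝ) ^ r⌉₊ - ⌈((l + i₀ : ℕ) : ℝ) ^ r⌉₊ : ℕ) : ℝ)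
      ≤ 5 * ((l + i₀ : ℕ) : ℝ) ^ (r - 1) := by
    intro l
    rw [Nat.cast_sub (hmono (Nat.le_succ l))]
    have := ceil_rpow_succ_sub_le hr1 hr2 (l := l + i₀) (by omega)
    rwa [show l + i₀ + 1 = l + 1 + i₀ by ring] at this
  refine ⟨fun l => ⌈((l + i₀ : ℕ) : ℝ) ^ r⌉₊, fun l => q (l + i₀), 5 * (i₀ + 2) ^ (r - 1), ?_, hmono,
    fun l => hq0 _, fun N => ?_, fun l => ?_, by positivity, fun n hn => ?_⟩
  · refine Nat.one_le_ceil_iff.2 (Real.rpow_pos_of_pos ?_ _)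
    exact_mod_cast (by omega : 0 < 0 + i₀)
  · exact (((summable_nat_add_iff i₀).2 hqs).sum_le_tsum _ fun l _ => hq0 _).trans hi₀
  · have hm1 : (1 : ℝ) ≤ ((l + i₀ : ℕ) : ℝ) := by exact_mod_cast (by omega : 1 ≤ l + i₀)
    have hL := hlen l
    beta_reduce
    set m : ℝ := ((l + i₀ : ℕ) : ℝ) with hm
    have hm0 : 0 < m := by linarith
    set s : ℝ := ((⌈((l + 1 + i₀ : ℕ) : ℝ) ^ r⌉₊ - ⌈m ^ r⌉₊ : ℕ) : ℝ) *
      (C / (⌈m ^ r⌉₊ : ℝ) ^ (1 + δ)) with hs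
    have hs0 : 0 ≤ s := by positivity
    have hden : m ^ (r * (1 + δ)) ≤ (⌈m ^ r⌉₊ : ℝ) ^ (1 + δ) := by
      rw [Real.rpow_mul hm0.le]
      exact Real.rpow_le_rpow (by positivity) (Nat.le_ceil _) (by linarith)
    have hsle : s ≤ 5 * C * (1 / m ^ (1 + r * δ)) := by
      calc s ≤ 5 * m ^ (r - 1) * (C / m ^ (r * (1 + δ))) := by
            refine mul_le_mul hL ?_ (by positivity) (by positivity)
            exact div_le_div_of_nonneg_left hC.le (by positivity) hden
        _ = 5 * C * (1 / m ^ (1 + r * δ)) := by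
            have : m ^ (r * (1 + δ)) = m ^ (r - 1) * m ^ (1 + r * δ) := by
              rw [← Real.rpow_add hm0]; congr 1; ring
            rw [this]
            field_simp
    have hone : 1 / m ^ (1 + r * δ) ≤ 1 := by
      rw [div_le_one (by positivity)]
      exact Real.one_le_rpow hm1 (by linarith)
    have hs5 : s ≤ 5 * C := hsle.trans (mul_le_of_le_one_right (by positivity) hone)
    have hexp : Real.exp s - 1 ≤ s * Real.exp s := by
      have h1 := Real.add_one_le_exp (-s)
      have h2 : Real.exp (-s) * Real.exp s = 1 := by rw [← Real.exp_add]; simp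
      nlinarith [Real.exp_pos s]
    refine hexp.trans ?_
    have hqsq : q (l + i₀) ^ 2 = 5 * C * (1 / m ^ (1 + r * δ)) * Real.exp (5 * C) := by
      have h1 : (m ^ ((1 + r * δ) / 2)) ^ 2 = m ^ (1 + r * δ) := by
        rw [← Real.rpow_natCast, ← Real.rpow_mul hm0.le]; congr 1; push_cast; ring
      simp only [hq]
      rw [← hm, mul_pow, Real.sq_sqrt (by positivity), div_pow, h1]
      ring
    rw [hqsq]
    exact mul_le_mul hsle (Real.exp_le_exp.2 hs5) (Real.exp_pos _).le (by positivity)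
  · have hn1 : (1 : ℝ) ≤ n := by exact_mod_cast hn
    have hnρ : 1 ≤ (n : ℝ) ^ ρ := Real.one_le_rpow hn1 hρ0.le
    refine ⟨⌈(n : ℝ) ^ ρ⌉₊, ?_, fun l hl => ?_⟩
    · have h1 : (n : ℝ) ≤ ((⌈(n : ℝ) ^ ρ⌉₊ + i₀ : ℕ) : ℝ) ^ r := by
        calc (n : ℝ) = ((n : ℝ) ^ ρ) ^ r := by rw [← Real.rpow_mul (by linarith), hρr, Real.rpow_one]
          _ ≤ _ := by
            refine Real.rpow_le_rpow (by positivity) ?_ (by linarith)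
            push_cast
            linarith [Nat.le_ceil ((n : ℝ) ^ ρ), (Nat.cast_nonneg i₀ : (0 : ℝ) ≤ i₀)]
      exact_mod_cast h1.trans (Nat.le_ceil _)
    · refine (hlen l).trans ?_
      rw [mul_assoc]
      refine mul_le_mul_of_nonneg_left ?_ (by norm_num)
      have h1 : ((l + i₀ : ℕ) : ℝ) ≤ (i₀ + 2) * (n : ℝ) ^ ρ := by
        have h2 : (l : ℝ) ≤ (⌈(n : ℝ) ^ ρ⌉₊ : ℝ) := by exact_mod_cast hl.le
        have h3 : (⌈(n : ℝ) ^ ρ⌉₊ : ℝ) < (n : ℝ) ^ ρ + 1 := Nat.ceil_lt_add_one (by positivity)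
        have h4 : (i₀ : ℝ) ≤ i₀ * (n : ℝ) ^ ρ := le_mul_of_one_le_right (by positivity) hnρ
        push_cast
        linarith
      calc ((l + i₀ : ℕ) : ℝ) ^ (r - 1) ≤ ((i₀ + 2) * (n : ℝ) ^ ρ) ^ (r - 1) :=
            Real.rpow_le_rpow (by positivity) h1 (by linarith)
        _ = (i₀ + 2 : ℝ) ^ (r - 1) * (n : ℝ) ^ (1 - ρ) := by
            rw [Real.mul_rpow (by positivity) (by positivity), ← Real.rpow_mul (by linarith)]
            congr 2
            linarith

/-- Summation of the block recursion: the oscillations `γ 0 j` with no common letters add up, for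
`j < n`, to a multiple of the largest block length. -/
lemma sum_range_le_of_blocks {γ : ℕ → ℕ → ℝ} {t : ℕ → ℕ} {p : ℕ → ℝ} {R c D : ℝ} {n N : ℕ}
    (hγ : ∀ k j, 0 ≤ γ k j) (hR : ∀ j, γ 0 j ≤ R) (hγ0 : ∀ k, 1 ≤ k → γ k 0 = 0)
    (ht0 : 1 ≤ t 0) (ht : Monotone t) (hp : ∀ l, 0 ≤ p l)
    (hps : ∑ l ∈ Finset.range N, p l ≤ 1 / 2) (hc : 0 < c) (hc1 : c ≤ 1)
    (hblock : ∀ l L j, L ≤ t (l + 1) - t l → γ (t l) (j + L) ≤ γ (t l + L) j + p l * γ 0 j)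
    (hstart : ∀ j, γ 0 (j + t 0) ≤ c * γ (t 0) j + (1 - c) * γ 0 j)
    (hnN : n ≤ t N) (hD0 : 0 ≤ D) (hD : ∀ l < N, ((t (l + 1) - t l : ℕ) : ℝ) ≤ D) :
    ∑ j ∈ Finset.range n, γ 0 j ≤ (2 * t 0 / c + D) * R := by
  set S := ∑ j ∈ Finset.range n, γ 0 j with hS
  have hR0 : 0 ≤ R := (hγ 0 0).trans (hR 0)
  have hS0 : 0 ≤ S := Finset.sum_nonneg fun _ _ => hγ _ _
  have hsub : ∀ m ≤ n, ∑ j ∈ Finset.range m, γ 0 j ≤ S := fun m hm =>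
    Finset.sum_le_sum_of_subset_of_nonneg (Finset.range_mono hm) fun _ _ _ => hγ _ _
  -- For times inside a block, the partial block of length `j` ends at `γ _ 0 = 0`, so only its
  -- failure contributes.
  have hshort : ∀ l < N, ∀ m ≤ t (l + 1) - t l,
      ∑ j ∈ Finset.range m, γ (t l) j ≤ p l * (D * R) := by
    intro l hl m hm
    calc ∑ j ∈ Finset.range m, γ (t l) j ≤ ∑ j ∈ Finset.range m, p l * R := by
          refine Finset.sum_le_sum fun j hj => ?_
          have hj' := Finset.mem_range.1 hj
          have h1 := hblock l j 0 (by omega)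
          rw [zero_add, hγ0 _ (by have := ht (Nat.zero_le l); omega), zero_add] at h1
          exact h1.trans (mul_le_mul_of_nonneg_left (hR 0) (hp l))
      _ = (m : ℝ) * (p l * R) := by simp
      _ ≤ D * (p l * R) := by
          refine mul_le_mul_of_nonneg_right ?_ (mul_nonneg (hp l) hR0)
          exact (Nat.cast_le.2 hm).trans (hD l hl)
      _ = _ := by ring
  -- Induction from the last block backwards; the constraint on `m` makes the sum empty at `i = 0`.
  -- Failure of block `l` costs `p l * (D * R)` for times inside it and `p l * S` for later ones.
  have hE : ∀ i ≤ N, ∀ m ≤ n, m + t (N - i) ≤ t N →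
      ∑ j ∈ Finset.range m, γ (t (N - i)) j
        ≤ ∑ l ∈ Finset.Ico (N - i) N, p l * (D * R + S) := by
    intro i
    induction i with
    | zero =>
      intro _ m _ hm
      obtain rfl : m = 0 := by simpa using hm
      simp
    | succ i ih =>
      intro hi m hmn hm
      obtain ⟨l, hl⟩ : ∃ l, l = N - (i + 1) := ⟨_, rfl⟩
      have hl1 : N - i = l + 1 := by omega
      rw [← hl] at hm ⊢
      rw [hl1] at ih
      have hlN : l < N := by omega
      have hle := ht (Nat.le_succ l)
      have hnext : 0 ≤ ∑ l ∈ Finset.Ico (l + 1) N, p l * (D * R + S) :=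
        Finset.sum_nonneg fun l _ => mul_nonneg (hp l) (by positivity)
      rw [Finset.sum_eq_sum_Ico_succ_bot hlN]
      rcases le_total m (t (l + 1) - t l) with hmL | hmL
      · have h1 := hshort l hlN m hmL
        have h2 := mul_nonneg (hp l) hS0
        linarith
      · obtain ⟨m', rfl⟩ := Nat.exists_eq_add_of_le hmL
        rw [Finset.sum_range_add]
        have h1 := hshort l hlN _ le_rfl
        have h2 := ih (by omega) m' (by omega) (by simp only [Nat.succ_eq_add_one] at hle; omega)
        have h3 : ∑ j ∈ Finset.range m', γ (t l) (t (l + 1) - t l + j)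
            ≤ ∑ j ∈ Finset.range m', γ (t (l + 1)) j + p l * S := by
          calc _ ≤ ∑ j ∈ Finset.range m', (γ (t (l + 1)) j + p l * γ 0 j) := by
                refine Finset.sum_le_sum fun j _ => ?_
                have h4 := hblock l (t (l + 1) - t l) j le_rfl
                rwa [Nat.add_sub_of_le hle, add_comm j] at h4
            _ ≤ _ := by
                rw [Finset.sum_add_distrib, ← Finset.mul_sum]
                have := mul_le_mul_of_nonneg_left (hsub m' (by omega)) (hp l)
                linarith
        linarith
  -- The coefficient of `S` on the right is `1 - c / 2`, so `S` can be absorbed on the left.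
  have hfin : S ≤ t 0 * R + c * (1 / 2 * (D * R + S)) + (1 - c) * S := by
    rcases le_total n (t 0) with hn | hn
    · have h1 : S ≤ t 0 * R := by
        calc S ≤ ∑ j ∈ Finset.range n, R := Finset.sum_le_sum fun j _ => hR j
          _ = n * R := by simp
          _ ≤ _ := mul_le_mul_of_nonneg_right (by exact_mod_cast hn) hR0
      have h2 : 0 ≤ c * (1 / 2 * (D * R + S)) := by positivity
      have h3 : 0 ≤ (1 - c) * S := mul_nonneg (by linarith) hS0
      linarith
    · obtain ⟨m, hm⟩ := Nat.exists_eq_add_of_le hn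
      have h0 : S = ∑ j ∈ Finset.range (t 0), γ 0 j + ∑ j ∈ Finset.range m, γ 0 (t 0 + j) := by
        rw [hS, hm, Finset.sum_range_add]
      have h1 : ∑ j ∈ Finset.range (t 0), γ 0 j ≤ t 0 * R := by
        calc _ ≤ ∑ j ∈ Finset.range (t 0), R := Finset.sum_le_sum fun j _ => hR j
          _ = _ := by simp
      have h2 : ∑ j ∈ Finset.range m, γ 0 (t 0 + j)
          ≤ c * ∑ j ∈ Finset.range m, γ (t 0) j + (1 - c) * ∑ j ∈ Finset.range m, γ 0 j := by
        rw [Finset.mul_sum, Finset.mul_sum, ← Finset.sum_add_distrib]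
        exact Finset.sum_le_sum fun j _ => by rw [add_comm]; exact hstart j
      have h3 := hE N le_rfl m (by omega) (by rw [Nat.sub_self]; omega)
      rw [Nat.sub_self, ← Finset.sum_mul, ← Finset.range_eq_Ico] at h3
      have h4 : (∑ l ∈ Finset.range N, p l) * (D * R + S) ≤ 1 / 2 * (D * R + S) :=
        mul_le_mul_of_nonneg_right hps (by positivity)
      have h5 := mul_le_mul_of_nonneg_left (h3.trans h4) hc.le
      have h6 := mul_le_mul_of_nonneg_left (hsub m (by omega)) (by linarith : 0 ≤ 1 - c)
      linarith
  have h7 : c * S ≤ 2 * t 0 * R + c * (D * R) := by linarith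
  have h8 : S ≤ (2 * t 0 * R + c * (D * R)) / c := by
    rw [le_div_iff₀ hc]; linarith
  refine h8.trans (le_of_eq ?_)
  field_simp

end Blocks

/-! ### The oscillation bound for a potential. -/

section Potentials

variable {A : Type*}

lemma finite_of_isPotential [MeasurableSpace A] [Nonempty A] {φ : Past A → ℝ} {ε : ℝ} (hε : 0 < ε)
    (hφ : IsPotential φ) (hφε : ∀ x, ε ≤ Real.exp (φ x)) : Finite A := by
  by_contra hA
  rw [not_finite_iff_infinite] at hA
  have x : Past A := fun _ => Classical.arbitrary A
  have := Summable.of_nonneg_of_le (fun _ : A => hε.le) (fun a => hφε (consPast a x))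
    (hφ.normalized x).summable
  exact hε.ne' ((summable_const_iff ε).1 this)

variable [Fintype A]

lemma sum_sq_sub_div_le_of_chiSqRate_le {φ : Past A → ℝ} {k : ℕ} {u : ℝ} (hu : 0 ≤ u)
    (h : chiSqRate φ k ≤ ENNReal.ofReal u) {x y : Past A} (hxy : AgreeUpTo k x y) :
    ∑ b, (Real.exp (φ (consPast b x)) - Real.exp (φ (consPast b y))) ^ 2
      / Real.exp (φ (consPast b y)) ≤ u := by
  obtain ⟨z, x', y', rfl, rfl⟩ := exists_concatPast k hxy
  have h1 := (le_iSup₂_of_le z x' (le_iSup_of_le y' le_rfl)).trans h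
  rw [tsum_fintype, ← ENNReal.ofReal_sum_of_nonneg (fun b _ => by positivity),
    ENNReal.ofReal_le_ofReal_iff hu] at h1
  exact h1

/-- The accumulated oscillation of the expectations of `h` at times `0, …, n - 1`, for any pasts,
grows at most like `n ^ (1 - ρ)`. -/
lemma exists_sum_ageOsc_le {C δ ρ ε : ℝ} (hC : 0 < C) (hρ : 1 / 2 ≤ ρ) (hρδ : ρ < δ)
    (hδ1 : δ ≤ 1) (hε : 0 < ε) :
    ∃ K : ℝ, 0 < K ∧ ∀ (A : Type*) [Fintype A] [Nonempty A] (φ F : Past A → ℝ) (m M : ℝ),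
      (∀ x, ∑ a, Real.exp (φ (consPast a x)) = 1) → (∀ x, ε ≤ Real.exp (φ x)) →
      (∀ k : ℕ, 1 ≤ k → chiSqRate φ k ≤ ENNReal.ofReal (C / (k : ℝ) ^ (1 + δ))) →
      (∀ x, F x ∈ Set.Icc m M) → (∀ x y, AgreeUpTo 1 x y → F x = F y) →
      ∀ n : ℕ, 1 ≤ n → ∑ j ∈ Finset.range n, ageOsc ((transfer φ)^[j] F) 0
        ≤ K * (n : ℝ) ^ (1 - ρ) * (M - m) := by
  obtain ⟨t, p, K, ht0, ht, hp, hps, hpt, hK, hN⟩ := exists_blocks hC hρ hρδ hδ1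
  -- The start-up cost `2 * t 0 / ε ^ t 0` is absorbed using `1 ≤ n ^ (1 - ρ)`.
  refine ⟨2 * t 0 / ε ^ t 0 + K, by positivity, ?_⟩
  intro A _ _ φ F m M hφ hφε hχ hF hF1 n hn
  have hε1 : ε ≤ 1 := by
    have x : Past A := fun _ => Classical.arbitrary A
    have a : A := Classical.arbitrary A
    rw [← hφ x]
    exact (hφε (consPast a x)).trans
      (Finset.single_le_sum (f := fun a => Real.exp (φ (consPast a x)))
        (fun _ _ => (Real.exp_pos _).le) (Finset.mem_univ a))
  have hmM : m ≤ M := by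
    have x : Past A := fun _ => Classical.arbitrary A
    exact (hF x).1.trans (hF x).2
  obtain ⟨N, hnN, hD⟩ := hN n hn
  have hn1 : (1 : ℝ) ≤ (n : ℝ) ^ (1 - ρ) :=
    Real.one_le_rpow (by exact_mod_cast hn) (by linarith)
  have hV : ∀ j x, (transfer φ)^[j] F x ∈ Set.Icc m M := transfer_iterate_mem_Icc hφ hF
  have key := sum_range_le_of_blocks (γ := fun k j => ageOsc ((transfer φ)^[j] F) k)
    (t := t) (p := p) (R := M - m) (c := ε ^ t 0) (D := K * (n : ℝ) ^ (1 - ρ)) (n := n) (N := N)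
    (fun k j => ageOsc_nonneg _ _)
    (fun j => ageOsc_le (by linarith) fun x y _ => abs_sub_le_sub_of_mem_Icc (hV j x) (hV j y))
    (fun k hk => le_antisymm (ageOsc_le le_rfl fun x y hxy => by
      rw [Function.iterate_zero, id, hF1 x y fun i hi => hxy i (by omega), sub_self, abs_zero])
      (ageOsc_nonneg _ _))
    ht0 ht hp (hps N) (by positivity) (pow_le_one₀ hε.le hε1)
    (fun l L j hL => by
      have htl : 1 ≤ t l := ht0.trans (ht (Nat.zero_le l))
      have htl' : (1 : ℝ) ≤ t l := by exact_mod_cast htl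
      have hu : 0 ≤ C / (t l : ℝ) ^ (1 + δ) := by positivity
      rw [add_comm j, Function.iterate_add_apply]
      refine ageOsc_transfer_iterate_le hφ (hV j) (hp l) fun x y hxy => ?_
      refine sum_abs_wordProb_sub_le hφ hu (hp l) (fun i hi x y hxy => ?_)
        (le_trans ?_ (hpt l)) hxy
      · refine (sum_sq_sub_div_le_of_chiSqRate_le (by positivity) (hχ i (htl.trans hi)) hxy).trans ?_
        refine div_le_div_of_nonneg_left hC.le (by positivity) ?_
        exact Real.rpow_le_rpow (by positivity) (by exact_mod_cast hi) (by linarith)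
      · refine sub_le_sub_right (Real.exp_le_exp.2 (mul_le_mul_of_nonneg_right ?_ hu)) 1
        exact_mod_cast hL)
    (fun j => by
      rw [add_comm j, Function.iterate_add_apply]
      exact ageOsc_transfer_iterate_zero_le hφ (hV j) hε.le hε1 hφε (t 0))
    hnN (by positivity) hD
  refine key.trans (mul_le_mul_of_nonneg_right ?_ (by linarith))
  rw [add_mul]
  exact add_le_add_left (le_mul_of_one_le_right (by positivity) hn1) _

end Potentials

/-! ### Compatible measures and Hoeffding's lemma. -/

section Compatible

variable {A : Type*} [MeasurableSpace A]

lemma measurable_pastOf (n : ℤ) : Measurable (pastOf (A := A) n) :=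
  measurable_pi_lambda _ fun _ => measurable_pi_apply _

lemma measurable_consPast (a : A) : Measurable (consPast a) := by
  refine measurable_pi_lambda _ fun i => ?_
  cases i with
  | zero => exact measurable_const
  | succ i => exact measurable_pi_apply i

omit [MeasurableSpace A] in
lemma pastOf_succ (n : ℕ) (ω : BiSeq A) :
    pastOf ((n + 1 : ℕ) : ℤ) ω = consPast (ω ((n : ℤ) + 1)) (pastOf n ω) := by
  funext i
  cases i with
  | zero => simp [pastOf, consPast]
  | succ i => simp only [pastOf, consPast]; congr 1; push_cast; ring

variable [Fintype A]

lemma measurable_transfer {φ F : Past A → ℝ} (hφ : Measurable φ) (hF : Measurable F) :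
    Measurable (transfer φ F) :=
  Finset.measurable_sum _ fun a _ =>
    (Real.measurable_exp.comp (hφ.comp (measurable_consPast a))).mul
      (hF.comp (measurable_consPast a))

/-- Under a compatible measure the transfer operator computes expectations one step ahead. -/
lemma integral_pastOf_succ [MeasurableSingletonClass A] {φ F : Past A → ℝ} {μ : Measure (BiSeq A)}
    (hμ : IsCompatible φ μ) (hF : Measurable F) {B : ℝ}
    (hB : ∀ x, |F x| ≤ B) {n : ℕ} (hn : 1 ≤ n) :
    ∫ ω, F (pastOf ((n + 1 : ℕ) : ℤ) ω) ∂μ = ∫ ω, transfer φ F (pastOf n ω) ∂μ := by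
  classical
  have := hμ.isProbabilityMeasure
  have hset : ∀ a : A, MeasurableSet {ω : BiSeq A | ω ((n : ℤ) + 1) = a} := fun a =>
    (measurableSet_singleton a).preimage (measurable_pi_apply ((n : ℤ) + 1))
  set m : MeasurableSpace (BiSeq A) :=
    MeasurableSpace.comap (pastOf (A := A) (n : ℤ)) inferInstance with hm
  have hm_le : m ≤ MeasurableSpace.pi := (measurable_pastOf (n : ℤ)).comap_le
  have hG : ∀ a, StronglyMeasurable[m] fun ω => F (consPast a (pastOf (n : ℤ) ω)) := fun a =>
    ((hF.comp (measurable_consPast a)).comp (comap_measurable _)).stronglyMeasurable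
  have hind : ∀ a : A, Integrable
      ({ω : BiSeq A | ω ((n : ℤ) + 1) = a}.indicator fun _ => (1 : ℝ)) μ := fun a =>
    (integrable_const 1).indicator (hset a)
  have hprod : ∀ a : A, Integrable (fun ω => F (consPast a (pastOf (n : ℤ) ω)) *
      {ω : BiSeq A | ω ((n : ℤ) + 1) = a}.indicator (fun _ => (1 : ℝ)) ω) μ := fun a =>
    (hind a).bdd_mul ((hG a).mono hm_le).aestronglyMeasurable (ae_of_all _ fun ω => hB _)
  -- With the new letter frozen at `a`, the factor `F` depends on the past only and leaves the
  -- conditional expectation.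
  have hpull : ∀ a : A, ∫ ω, F (consPast a (pastOf (n : ℤ) ω)) *
        {ω : BiSeq A | ω ((n : ℤ) + 1) = a}.indicator (fun _ => (1 : ℝ)) ω ∂μ
      = ∫ ω, Real.exp (φ (consPast a (pastOf n ω))) * F (consPast a (pastOf (n : ℤ) ω)) ∂μ := by
    intro a
    rw [← integral_condExp hm_le]
    refine integral_congr_ae ?_
    have h1 := condExp_mul_of_stronglyMeasurable_left (hG a) (hprod a) (hind a)
    filter_upwards [h1, hμ.cond_prob n hn a] with ω h2 h3
    rw [mul_comm (Real.exp _), ← h3]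
    exact h2
  have hint : ∀ a : A, Integrable
      (fun ω => Real.exp (φ (consPast a (pastOf n ω))) * F (consPast a (pastOf (n : ℤ) ω))) μ := by
    intro a
    have h1 := (integrable_condExp (m := m) (μ := μ)
      (f := {ω : BiSeq A | ω ((n : ℤ) + 1) = a}.indicator fun _ => (1 : ℝ))).congr
      (hμ.cond_prob n hn a)
    exact h1.mul_bdd (c := B) ((hG a).mono hm_le).aestronglyMeasurable (ae_of_all _ fun ω => hB _)
  calc ∫ ω, F (pastOf ((n + 1 : ℕ) : ℤ) ω) ∂μ
      = ∫ ω, ∑ a, F (consPast a (pastOf (n : ℤ) ω)) *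
        {ω : BiSeq A | ω ((n : ℤ) + 1) = a}.indicator (fun _ => (1 : ℝ)) ω ∂μ := by
        refine integral_congr_ae (ae_of_all _ fun ω => ?_)
        simp only [pastOf_succ]
        simp [Set.indicator_apply]
    _ = _ := by
        rw [integral_finsetSum _ fun a _ => hprod a]
        simp_rw [hpull, transfer]
        rw [integral_finsetSum _ fun a _ => hint a]

/-- Hoeffding's lemma. -/
lemma exp_integral_le {Ω : Type*} [MeasurableSpace Ω] {μ : Measure Ω} [IsProbabilityMeasure μ]
    {X : Ω → ℝ} (hX : Measurable X) {c : ℝ} (hc : ∀ ω ω', X ω - X ω' ≤ c) (s : ℝ) :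
    ∫ ω, Real.exp (s * X ω) ∂μ ≤ Real.exp (c ^ 2 * s ^ 2 / 8) * Real.exp (s * ∫ ω, X ω ∂μ) := by
  obtain ⟨ω₀⟩ : Nonempty Ω := μ.nonempty_of_neZero
  have hbd : BddBelow (Set.range X) := ⟨X ω₀ - c, by rintro _ ⟨ω, rfl⟩; linarith [hc ω₀ ω]⟩
  have : Nonempty Ω := ⟨ω₀⟩
  have hmem : ∀ ω, X ω ∈ Set.Icc (⨅ ω, X ω) ((⨅ ω, X ω) + c) := fun ω =>
    ⟨ciInf_le hbd ω, by
      have : X ω - c ≤ ⨅ ω, X ω := le_ciInf fun ω' => by linarith [hc ω ω']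
      linarith⟩
  have h := (hasSubgaussianMGF_of_mem_Icc (μ := μ) hX.aemeasurable (ae_of_all _ hmem)).mgf_le s
  have e : mgf (fun ω => X ω - ∫ ω, X ω ∂μ) μ s
      = (∫ ω, Real.exp (s * X ω) ∂μ) * Real.exp (-(s * ∫ ω, X ω ∂μ)) := by
    rw [mgf, ← integral_mul_const]
    refine integral_congr_ae (ae_of_all _ fun ω => ?_)
    simp only [← Real.exp_add]
    congr 1
    ring
  rw [e, Real.exp_neg, ← div_eq_mul_inv, div_le_iff₀ (Real.exp_pos _)] at h
  refine h.trans (le_of_eq ?_)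
  congr 2
  have h0 : 0 ≤ c := by simpa using hc ω₀ ω₀
  push_cast
  simp only [add_sub_cancel_left, Real.norm_eq_abs]
  rw [div_pow, sq_abs]
  ring

/-- Hoeffding's lemma for finitely many weights. -/
lemma sum_mul_exp_le [MeasurableSingletonClass A] {w f : A → ℝ} {c : ℝ} (hw : ∀ a, 0 ≤ w a)
    (hw1 : ∑ a, w a = 1) (hf : ∀ a b, f a - f b ≤ c) (s : ℝ) :
    ∑ a, w a * Real.exp (s * f a)
      ≤ Real.exp (c ^ 2 * s ^ 2 / 8) * Real.exp (s * ∑ a, w a * f a) := by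
  set ν : Measure A := ∑ a, ENNReal.ofReal (w a) • Measure.dirac a with hν
  have : IsProbabilityMeasure ν := ⟨by
    simp only [hν, Measure.coe_finsetSum, Finset.sum_apply, Measure.smul_apply, measure_univ,
      smul_eq_mul, mul_one]
    rw [← ENNReal.ofReal_sum_of_nonneg fun a _ => hw a, hw1, ENNReal.ofReal_one]⟩
  have hint : ∀ g : A → ℝ, ∫ a, g a ∂ν = ∑ a, w a * g a := by
    intro g
    rw [hν, integral_finsetSum_measure fun a _ =>
      (integrable_dirac (by finiteness)).smul_measure ENNReal.ofReal_ne_top]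
    refine Finset.sum_congr rfl fun a _ => ?_
    rw [integral_smul_measure, integral_dirac, ENNReal.toReal_ofReal (hw a), smul_eq_mul]
  have h := exp_integral_le (μ := ν) (measurable_of_countable f) hf s
  rwa [hint, hint] at h

end Compatible

/-! ### The Doob martingale and its exponential moments. -/

section Martingale

variable {A : Type*} [Fintype A]

/-- The conditional expectation of `∑ h`, given the past, in the case where `m - 1` letters are
still to come: the letters `x 1, …, x i` of the past contribute `h` itself. -/
def condSum (φ : Past A → ℝ) (h : A → ℝ) (i m : ℕ) : Past A → ℝ := fun x =>
  ∑ l ∈ Finset.range i, h (x (l + 1))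
    + ∑ j ∈ Finset.range m, (transfer φ)^[j] (fun y => h (y 0)) x

variable {φ : Past A → ℝ} {h : A → ℝ}

lemma condSum_consPast (i m : ℕ) (a : A) (x : Past A) :
    condSum φ h i m (consPast a x) = ∑ l ∈ Finset.range i, h (x l)
      + ∑ j ∈ Finset.range m, (transfer φ)^[j] (fun y => h (y 0)) (consPast a x) := rfl

/-- The martingale property: averaging over the newest letter raises every iterate by one, and `h (x
0)` takes the vacant place `j = 0`. -/
lemma transfer_condSum (hφ : ∀ x, ∑ a, Real.exp (φ (consPast a x)) = 1) (i m : ℕ) (x : Past A) :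
    transfer φ (condSum φ h (i + 1) m) x = condSum φ h i (m + 1) x := by
  simp only [transfer, condSum_consPast, mul_add, Finset.sum_add_distrib]
  rw [← Finset.sum_mul, hφ, one_mul, condSum, Finset.sum_range_succ', Finset.sum_range_succ' _ m]
  simp only [Finset.mul_sum, Function.iterate_succ_apply', Function.iterate_zero, id]
  rw [Finset.sum_comm]
  simp only [transfer]
  ring

lemma condSum_pastOf (n : ℕ) (ω : BiSeq A) :
    condSum φ h n 1 (pastOf ((n + 1 : ℕ) : ℤ) ω) = ∑ i ∈ Finset.Icc 1 (n + 1), h (ω (i : ℤ)) := by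
  have hIcc : Finset.Icc 1 (n + 1) = Finset.Ico (0 + 1) (n + 1 + 1) := by
    ext i
    simp only [Finset.mem_Icc, Finset.mem_Ico]
    omega
  rw [hIcc, condSum, Finset.sum_range_one, Function.iterate_zero, id,
    ← Finset.sum_range_succ' fun l => h (pastOf ((n + 1 : ℕ) : ℤ) ω l),
    ← Finset.sum_range_reflect, Finset.range_eq_Ico,
    ← Finset.sum_Ico_add' (fun i : ℕ => h (ω (i : ℤ))) 0 (n + 1) 1]
  refine Finset.sum_congr rfl fun l hl => ?_
  have := (Finset.mem_Ico.1 hl).2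
  simp only [pastOf]
  congr 2
  omega

lemma exists_abs_condSum_le (hφ : ∀ x, ∑ a, Real.exp (φ (consPast a x)) = 1) (h : A → ℝ)
    (i m : ℕ) : ∃ B, ∀ x, |condSum φ h i m x| ≤ B := by
  have hM : ∀ a, |h a| ≤ ∑ b, |h b| := fun a =>
    Finset.single_le_sum (f := fun b => |h b|) (fun _ _ => abs_nonneg _) (Finset.mem_univ a)
  refine ⟨∑ l ∈ Finset.range i, ∑ b, |h b| + ∑ j ∈ Finset.range m, ∑ b, |h b|, fun x => ?_⟩
  refine (abs_add_le _ _).trans (add_le_add ?_ ?_)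
  · exact (Finset.abs_sum_le_sum_abs _ _).trans (Finset.sum_le_sum fun l _ => hM _)
  · refine (Finset.abs_sum_le_sum_abs _ _).trans (Finset.sum_le_sum fun j _ => abs_le.2 ?_)
    exact transfer_iterate_mem_Icc hφ (fun y => abs_le.1 (hM (y 0))) j x

variable [MeasurableSpace A] [MeasurableSingletonClass A] {μ : Measure (BiSeq A)}

lemma measurable_condSum (hφm : Measurable φ) (i m : ℕ) : Measurable (condSum φ h i m) := by
  have hh : ∀ l : ℕ, Measurable fun x : Past A => h (x l) := fun l =>
    (measurable_of_countable h).comp (measurable_pi_apply l)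
  refine (Finset.measurable_sum _ fun l _ => hh (l + 1)).add
    (Finset.measurable_sum _ fun j hj => ?_)
  clear hj
  induction j with
  | zero => exact hh 0
  | succ j ih =>
    rw [Function.iterate_succ_apply']
    exact measurable_transfer hφm ih

lemma integral_condSum (hφm : Measurable φ) (hφ : ∀ x, ∑ a, Real.exp (φ (consPast a x)) = 1)
    (hμ : IsCompatible φ μ) (i : ℕ) : ∀ m k : ℕ,
    ∫ ω, condSum φ h (i + m) k (pastOf ((i + m + 1 : ℕ) : ℤ) ω) ∂μ
      = ∫ ω, condSum φ h i (m + k) (pastOf ((i + 1 : ℕ) : ℤ) ω) ∂μ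
  | 0, k => by simp
  | m + 1, k => by
    obtain ⟨B, hB⟩ := exists_abs_condSum_le hφ h (i + m + 1) k
    rw [← add_assoc i m 1, integral_pastOf_succ hμ (measurable_condSum hφm _ _) hB
      (Nat.le_add_left 1 (i + m))]
    simp_rw [transfer_condSum hφ]
    rw [integral_condSum hφm hφ hμ i m (k + 1)]
    ring_nf

/-- Azuma's argument, peeling off the latest letter. Contributions of older letters cancel in
differences over that letter, so its range is controlled by `condSum φ h 0 k`. -/
lemma integral_exp_condSum_le (hφm : Measurable φ)
    (hφ : ∀ x, ∑ a, Real.exp (φ (consPast a x)) = 1) (hμ : IsCompatible φ μ) (s : ℝ) {c : ℝ}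
    {n : ℕ} (hc : ∀ k ≤ n, ∀ x y, condSum φ h 0 k x - condSum φ h 0 k y ≤ c) (i : ℕ) :
    ∀ m k : ℕ, m + k ≤ n →
    ∫ ω, Real.exp (s * condSum φ h (i + m) k (pastOf ((i + m + 1 : ℕ) : ℤ) ω)) ∂μ
      ≤ Real.exp (m * (c ^ 2 * s ^ 2 / 8)) *
        ∫ ω, Real.exp (s * condSum φ h i (m + k) (pastOf ((i + 1 : ℕ) : ℤ) ω)) ∂μ
  | 0, k, _ => by simp
  | m + 1, k, hmk => by
    have := hμ.isProbabilityMeasure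
    have hexpm : ∀ i k, Measurable fun x => Real.exp (s * condSum φ h i k x) := fun i k =>
      Real.measurable_exp.comp ((measurable_condSum hφm i k).const_mul s)
    have hexpb : ∀ i k, ∃ B, ∀ x, |Real.exp (s * condSum φ h i k x)| ≤ B := by
      intro i k
      obtain ⟨B, hB⟩ := exists_abs_condSum_le hφ h i k
      refine ⟨Real.exp (|s| * B), fun x => ?_⟩
      rw [Real.abs_exp]
      refine Real.exp_le_exp.2 ((le_abs_self _).trans ?_)
      rw [abs_mul]
      exact mul_le_mul_of_nonneg_left (hB x) (abs_nonneg s)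
    obtain ⟨B, hB⟩ := hexpb (i + m + 1) k
    rw [← add_assoc i m 1, integral_pastOf_succ hμ (hexpm _ _) hB
      (Nat.le_add_left 1 (i + m))]
    have hstep : ∀ x, transfer φ (fun x => Real.exp (s * condSum φ h (i + m + 1) k x)) x
        ≤ Real.exp (c ^ 2 * s ^ 2 / 8) * Real.exp (s * condSum φ h (i + m) (k + 1) x) := by
      intro x
      rw [← transfer_condSum hφ]
      refine sum_mul_exp_le (fun a => (Real.exp_pos _).le) (hφ x) (fun a b => ?_) s
      have := hc k (by omega) (consPast a x) (consPast b x)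
      rw [condSum_consPast, condSum_consPast] at this ⊢
      simp only [Finset.range_zero, Finset.sum_empty] at this
      linarith
    obtain ⟨B', hB'⟩ := hexpb (i + m) (k + 1)
    have hint : Integrable (fun ω => Real.exp (c ^ 2 * s ^ 2 / 8) *
        Real.exp (s * condSum φ h (i + m) (k + 1) (pastOf ((i + m + 1 : ℕ) : ℤ) ω))) μ :=
      (Integrable.of_bound ((hexpm _ _).comp (measurable_pastOf _)).aestronglyMeasurable B'
        (ae_of_all _ fun ω => hB' _)).const_mul _
    calc _ ≤ ∫ ω, Real.exp (c ^ 2 * s ^ 2 / 8) *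
          Real.exp (s * condSum φ h (i + m) (k + 1) (pastOf ((i + m + 1 : ℕ) : ℤ) ω)) ∂μ :=
          integral_mono_of_nonneg
            (ae_of_all _ fun ω => Finset.sum_nonneg fun a _ => by positivity) hint
            (ae_of_all _ fun ω => hstep _)
      _ ≤ Real.exp (c ^ 2 * s ^ 2 / 8) * (Real.exp (m * (c ^ 2 * s ^ 2 / 8)) *
          ∫ ω, Real.exp (s * condSum φ h i (m + (k + 1)) (pastOf ((i + 1 : ℕ) : ℤ) ω)) ∂μ) := by
          rw [integral_const_mul]
          exact mul_le_mul_of_nonneg_left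
            (integral_exp_condSum_le hφm hφ hμ s hc i m (k + 1) (by omega)) (Real.exp_pos _).le
      _ = _ := by
          rw [← mul_assoc, ← Real.exp_add, show m + (k + 1) = m + 1 + k by ring]
          congr 2
          push_cast
          ring

/-- The centered sums of `h` along the chain are sub-Gaussian. -/
lemma hasSubgaussianMGF_sum (hφm : Measurable φ)
    (hφ : ∀ x, ∑ a, Real.exp (φ (consPast a x)) = 1) (hμ : IsCompatible φ μ) {c : ℝ}
    {n : ℕ} (hn : 1 ≤ n)
    (hc : ∑ j ∈ Finset.range n, ageOsc ((transfer φ)^[j] fun y => h (y 0)) 0 ≤ c) :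
    HasSubgaussianMGF
      (fun ω => ∑ i ∈ Finset.Icc 1 n, (h (ω (i : ℤ)) - ∫ ω', h (ω' (i : ℤ)) ∂μ))
      (Real.toNNReal (n * c ^ 2 / 4)) μ := by
  have := hμ.isProbabilityMeasure
  obtain ⟨N, rfl⟩ : ∃ N, n = N + 1 := ⟨n - 1, by omega⟩
  have hosc : ∀ k ≤ N + 1, ∀ x y, condSum φ h 0 k x - condSum φ h 0 k y ≤ c := by
    intro k hk x y
    have hM : ∀ a, |h a| ≤ ∑ b, |h b| := fun a =>
      Finset.single_le_sum (f := fun b => |h b|) (fun _ _ => abs_nonneg _) (Finset.mem_univ a)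
    simp only [condSum, Finset.range_zero, Finset.sum_empty, zero_add, ← Finset.sum_sub_distrib]
    refine le_trans ?_ ((Finset.sum_le_sum_of_subset_of_nonneg (Finset.range_mono hk)
      fun _ _ _ => ageOsc_nonneg _ _).trans hc)
    exact Finset.sum_le_sum fun j _ => (le_abs_self _).trans (abs_sub_le_ageOsc
      (transfer_iterate_mem_Icc hφ (fun y => abs_le.1 (hM (y 0))) j) (agreeUpTo_zero _ _))
  obtain ⟨B, hB⟩ := exists_abs_condSum_le hφ h N 1
  set Y : BiSeq A → ℝ := fun ω => condSum φ h N 1 (pastOf ((N + 1 : ℕ) : ℤ) ω) with hY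
  have hYm : Measurable Y := (measurable_condSum hφm _ _).comp (measurable_pastOf _)
  have hcoord : ∀ i : ℕ, Integrable (fun ω : BiSeq A => h (ω (i : ℤ))) μ := fun i =>
    Integrable.of_bound
      ((measurable_of_countable h).comp (measurable_pi_apply (i : ℤ))).aestronglyMeasurable
      (∑ b, |h b|) (ae_of_all _ fun ω => Finset.single_le_sum (f := fun b => |h b|)
        (fun _ _ => abs_nonneg _) (Finset.mem_univ _))
  have hX : (fun ω : BiSeq A => ∑ i ∈ Finset.Icc 1 (N + 1),
      (h (ω (i : ℤ)) - ∫ ω', h (ω' (i : ℤ)) ∂μ)) = fun ω => Y ω - ∫ ω', Y ω' ∂μ := by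
    funext ω
    rw [Finset.sum_sub_distrib, ← integral_finsetSum _ fun i _ => hcoord i]
    simp only [hY, condSum_pastOf]
  have hexp : ∀ s ω, Real.exp (s * (Y ω - ∫ ω', Y ω' ∂μ))
      = Real.exp (s * Y ω) * Real.exp (-(s * ∫ ω', Y ω' ∂μ)) := fun s ω => by
    rw [← Real.exp_add]; ring_nf
  have hmean : ∫ ω, Y ω ∂μ = ∫ ω, condSum φ h 0 (N + 1) (pastOf ((0 + 1 : ℕ) : ℤ) ω) ∂μ := by
    have := integral_condSum (h := h) hφm hφ hμ 0 N 1
    simpa only [zero_add] using this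
  rw [hX]
  refine ⟨fun s => ?_, fun s => ?_⟩
  · simp_rw [hexp]
    refine Integrable.mul_const (Integrable.of_bound
      (Real.measurable_exp.comp (hYm.const_mul s)).aestronglyMeasurable (Real.exp (|s| * B))
      (ae_of_all _ fun ω => ?_)) _
    rw [Real.norm_eq_abs, Function.comp_apply, Real.abs_exp]
    refine Real.exp_le_exp.2 ((le_abs_self _).trans ?_)
    rw [abs_mul]
    exact mul_le_mul_of_nonneg_left (hB _) (abs_nonneg s)
  · simp_rw [mgf, hexp]
    rw [integral_mul_const, Real.coe_toNNReal _ (by positivity)]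
    have h1 := integral_exp_condSum_le hφm hφ hμ s hosc 0 N 1 le_rfl
    -- Compatibility gives no kernel for the letter at time 1. The last of the `n` Hoeffding factors
    -- is taken under `μ` itself, which works since `hosc` compares arbitrary pasts.
    have h2 := exp_integral_le (μ := μ)
      ((measurable_condSum (h := h) hφm 0 (N + 1)).comp (measurable_pastOf ((0 + 1 : ℕ) : ℤ)))
      (fun ω ω' => hosc (N + 1) le_rfl _ _) s
    simp only [Function.comp_apply] at h2
    rw [← hmean] at h2
    have h3 : ∫ ω, Real.exp (s * Y ω) ∂μ ≤ Real.exp (N * (c ^ 2 * s ^ 2 / 8)) *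
        (Real.exp (c ^ 2 * s ^ 2 / 8) * Real.exp (s * ∫ ω, Y ω ∂μ)) := by
      refine le_trans ?_ (mul_le_mul_of_nonneg_left h2 (Real.exp_pos _).le)
      simpa only [zero_add] using h1
    refine (mul_le_mul_of_nonneg_right h3 (Real.exp_pos _).le).trans (le_of_eq ?_)
    rw [← Real.exp_add, ← Real.exp_add, ← Real.exp_add]
    congr 1
    push_cast
    ring

end Martingale

/-! ### Two-sided tail bound and conclusion. -/

lemma ProbabilityTheory.HasSubgaussianMGF.measureReal_abs_ge_le {Ω : Type*} [MeasurableSpace Ω]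
    {μ : Measure Ω} [IsFiniteMeasure μ] {X : Ω → ℝ} {v : NNReal} (hX : HasSubgaussianMGF X v μ)
    {r : ℝ} (hr : 0 ≤ r) : μ.real {ω | r ≤ |X ω|} ≤ 2 * Real.exp (-r ^ 2 / (2 * v)) := by
  have h1 := hX.measure_ge_le hr
  have h2 := hX.neg.measure_ge_le hr
  have hsub : {ω | r ≤ |X ω|} ⊆ {ω | r ≤ X ω} ∪ {ω | r ≤ (-X) ω} := 
    fun ω hω => le_abs.1 (Set.mem_ofPred.1 hω)
  calc μ.real {ω | r ≤ |X ω|} ≤ μ.real ({ω | r ≤ X ω} ∪ {ω | r ≤ (-X) ω}) := measureReal_mono hsub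
    _ ≤ μ.real {ω | r ≤ X ω} + μ.real {ω | r ≤ (-X) ω} := measureReal_union_le _ _
    _ ≤ _ := by linarith

end

theorem mainTheorem6 (C δ δ' ε : ℝ) (hC : 0 < C) (hδ : 1 / 2 < δ) (hδ1 : δ ≤ 1)
    (hδ' : δ' < 2 * δ - 1) (hε : 0 < ε) :
    ∃ C₇ : ℝ, 0 < C₇ ∧
      ∀ (A : Type*) [Countable A] [MeasurableSpace A] [MeasurableSingletonClass A]
        (φ : Past A → ℝ), IsRegularPotential φ → (∀ x : Past A, ε ≤ Real.exp (φ x)) →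
        AssumptionA φ C δ →
        ∀ μ : Measure (BiSeq A), IsCompatible φ μ →
        ∀ (n : ℕ), 1 ≤ n → ∀ (t : ℝ), 0 ≤ t → ∀ (h : A → ℝ),
          μ.real {ω : BiSeq A |
              t ≤ |(1 / (n : ℝ)) *
                ∑ i ∈ Finset.Icc 1 n, (h (ω (i : ℤ)) - ∫ ω', h (ω' (i : ℤ)) ∂μ)|}
            ≤ 2 * Real.exp (-(C₇ * (n : ℝ) ^ δ' * t ^ 2 / oscRange h ^ 2)) := by
  -- The second entry gives `2ρ - 1 ≥ δ'`; the first keeps the block exponent `1/ρ ≤ 2` when `δ' <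
  -- 0`.
  set ρ : ℝ := max (1 / 2) ((1 + δ') / 2) with hρ
  have hρ1 : 1 / 2 ≤ ρ := le_max_left _ _
  have hρ2 : (1 + δ') / 2 ≤ ρ := le_max_right _ _
  have hρδ : ρ < δ := max_lt hδ (by linarith)
  obtain ⟨K, hK, hbound⟩ := exists_sum_ageOsc_le hC hρ1 hρδ hδ1 hε
  -- Variance proxy `n c² / 4` at level `n t` gives the exponent `2 n t² / c²`, with `c = K n^(1-ρ)
  -- R(h)`.
  refine ⟨2 / K ^ 2, by positivity, ?_⟩
  intro A _ _ _ φ _ hφε hA μ hμ n hn t ht h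
  have := hμ.isProbabilityMeasure
  obtain ⟨ω₀⟩ : Nonempty (BiSeq A) := μ.nonempty_of_neZero
  have : Nonempty A := ⟨ω₀ 0⟩
  have : Finite A := finite_of_isPotential hε hA.potential hφε
  have := Fintype.ofFinite A
  have hφ : ∀ x, ∑ a, Real.exp (φ (consPast a x)) = 1 := fun x => by
    rw [← (hA.potential.normalized x).tsum_eq, tsum_fintype]
  have hh : ∀ x : Past A, h (x 0) ∈ Set.Icc (⨅ a, h a) (⨆ a, h a) := fun x =>
    ⟨ciInf_le (Set.finite_range h).bddBelow _, le_ciSup (Set.finite_range h).bddAbove _⟩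
  have hsum := hbound A φ (fun x => h (x 0)) _ _ hφ hφε hA.bound hh
    (fun x y hxy => congrArg h (hxy 0 one_pos)) n hn
  have hn0 : (0 : ℝ) < n := by exact_mod_cast hn
  have hn1 : (1 : ℝ) ≤ n := by exact_mod_cast hn
  have hX := (hasSubgaussianMGF_sum (h := h) hA.potential.measurable hφ hμ hn hsum
    ).measureReal_abs_ge_le (mul_nonneg hn0.le ht)
  have hset : ∀ ω : BiSeq A,
      (t ≤ |(1 / (n : ℝ)) * ∑ i ∈ Finset.Icc 1 n, (h (ω (i : ℤ)) - ∫ ω', h (ω' (i : ℤ)) ∂μ)|)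
      ↔ n * t ≤ |∑ i ∈ Finset.Icc 1 n, (h (ω (i : ℤ)) - ∫ ω', h (ω' (i : ℤ)) ∂μ)| := by
    intro ω
    rw [abs_mul, abs_of_pos (one_div_pos.2 hn0), one_div, ← div_eq_inv_mul, le_div_iff₀' hn0]
  simp_rw [hset]
  refine hX.trans (mul_le_mul_of_nonneg_left (Real.exp_le_exp.2 ?_) two_pos.le)
  rw [Real.coe_toNNReal _ (by positivity), neg_div, neg_le_neg_iff]
  change 2 / K ^ 2 * (n : ℝ) ^ δ' * t ^ 2 / oscRange h ^ 2
    ≤ (n * t) ^ 2 / (2 * (n * (K * (n : ℝ) ^ (1 - ρ) * oscRange h) ^ 2 / 4))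
  have hpow : (n : ℝ) ^ δ' * ((n : ℝ) ^ (1 - ρ)) ^ 2 ≤ n := by
    rw [← Real.rpow_natCast, ← Real.rpow_mul hn0.le, ← Real.rpow_add hn0]
    calc (n : ℝ) ^ (δ' + (1 - ρ) * (2 : ℕ)) ≤ (n : ℝ) ^ (1 : ℝ) :=
          Real.rpow_le_rpow_of_exponent_le hn1 (by push_cast; linarith)
      _ = n := Real.rpow_one _
  -- For constant `h` both quotients are 0 by the convention for division by zero.
  rcases eq_or_ne (oscRange h) 0 with hR | hR
  · simp [hR]
  have hR2 : 0 < oscRange h ^ 2 := by positivity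
  have hm0 : 0 < (n : ℝ) ^ (1 - ρ) := by positivity
  rw [div_le_div_iff₀ hR2 (by positivity)]
  have e : 2 / K ^ 2 * (n : ℝ) ^ δ' * t ^ 2
        * (2 * (n * (K * (n : ℝ) ^ (1 - ρ) * oscRange h) ^ 2 / 4))
      = (n : ℝ) * t ^ 2 * oscRange h ^ 2 * ((n : ℝ) ^ δ' * ((n : ℝ) ^ (1 - ρ)) ^ 2) := by
    field_simp
    ring
  rw [e]
  calc _ ≤ (n : ℝ) * t ^ 2 * oscRange h ^ 2 * n := mul_le_mul_of_nonneg_left hpow (by positivity)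
    _ = _ := by ring
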